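/- For a finite nonempty set $X$ in a Euclidean space and a nonempty $\mathcal F\subseteq X$ let $$\mathrm{cost}_X(\mathcal F)=|\mathcal F|+\sum_{x\in X}\min_{f\in\mathcal F}\|x-f\|^2$$ be the squared facility-location cost, and let $\mathrm{OPT}(X)=\min_{\emptyset\ne\mathcal F\subseteq X}\mathrm{cost}_X(\mathcal F)$; $\mathcal F$ is optimal for $X$ if it attains this minimum. A random projection from $\mathbb R^m$ to $\mathbb R^d$ is a random linear map $G$ whose matrix has i.i.d. $\mathcal N(0,1/d)$ entries. Let $d=d(n)\ge 1$ be integers with $d(n)=o(\log n)$. Then there are scale factors $R(n)\ge 1$ and functions $\varepsilon(n)\to 0$ and $A(n)\to\infty$ as $n\to\infty$, depending only on the sequence $d$, such that for all integers $m\ge n\ge 1$ the set of scaled standard basis vectors $X=\{R(n)e_1,\dots,R(n)e_n\}\subset\mathbb R^m$ has $|X|=n$ and, with probability at least $2/3$ over a random projection $G:\mathbb R^m\to\mathbb R^{d(n)}$, both of the following hold: 1. $\mathrm{OPT}(GX)\le\varepsilon(n)\cdot\mathrm{OPT}(X)$; 2. an optimal solution for $GX$ exists, and every optimal solution $\widetilde{\mathcal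 F}\subseteq GX$ for $GX$, pulled back to $X$ as $\mathcal F=\{x\in X: Gx\in\widetilde{\mathcal F}\}$, satisfies $\mathrm{cost}_X(\mathcal F)\ge A(n)\cdot\mathrm{OPT}(X)$. -/

import Mathlib

open Filter Topology MeasureTheory ProbabilityTheory Asymptotics
open scoped NNReal ENNReal

noncomputable section

namespace SqFL

/-- The squared facility-location cost of a set `F` of open facilities for the dataset `X`, with
uniform opening cost `1`:  `|F| + ∑_{x ∈ X} min_{f ∈ F} ‖x - f‖²`.
(It is only used for nonempty `F`, where the infimum is a minimum.) -/
def cost {E : Type*} [NormedAddCommGroup E] (X F : Finset E) : ℝ :=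
  (F.card : ℝ) + ∑ x ∈ X, ⨅ f : F, ‖x - (f : E)‖ ^ 2

/-- A feasible solution for the dataset `X`: a nonempty set of facilities contained in `X`. -/
def IsSolution {E : Type*} (X F : Finset E) : Prop :=
  F ⊆ X ∧ F.Nonempty

/-- An optimal solution: a feasible solution of minimum cost. -/
def IsOptimal {E : Type*} [NormedAddCommGroup E] (X F : Finset E) : Prop :=
  IsSolution X F ∧ ∀ F' : Finset E, IsSolution X F' → cost X F ≤ cost X F'

/-- The optimal squared facility-location cost of the dataset `X`. -/
def optCost {E : Type*} [NormedAddCommGroup E] (X : Finset E) : ℝ :=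
  sInf (cost X '' {F | IsSolution X F})

/-- The law of the columns `g 0, …, g (m - 1)` of a random `d × m` matrix with i.i.d. entries
distributed as `N(0, 1/d)`; `g j i` is the entry in row `i` and column `j`. -/
def projLaw (d m : ℕ) : Measure (Fin m → Fin d → ℝ) :=
  Measure.pi fun _ : Fin m => Measure.pi fun _ : Fin d => gaussianReal 0 (1 / (d : ℝ≥0))

/-- The linear map `ℝ^m → ℝ^d` whose matrix has the columns `g j`. -/
def proj {d m : ℕ} (g : Fin m → Fin d → ℝ) :
    EuclideanSpace ℝ (Fin m) →ₗ[ℝ] EuclideanSpace ℝ (Fin d) :=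
  Matrix.toEuclideanLin (Matrix.of fun i j => g j i)

open Classical in
/-- The projected dataset `GX`. -/
def projImage {d m : ℕ} (g : Fin m → Fin d → ℝ) (X : Finset (EuclideanSpace ℝ (Fin m))) :
    Finset (EuclideanSpace ℝ (Fin d)) :=
  X.image (proj g)

open Classical in
/-- The facilities in `X` that correspond to a set `F` of facilities in `GX`. -/
def pullback {d m : ℕ} (g : Fin m → Fin d → ℝ) (X : Finset (EuclideanSpace ℝ (Fin m)))
    (F : Finset (EuclideanSpace ℝ (Fin d))) : Finset (EuclideanSpace ℝ (Fin m)) :=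
  X.filter fun x => proj g x ∈ F

open Classical in
/-- The scaled standard basis vectors `r e_0, …, r e_{n-1}` in `ℝ^m` (used for `n ≤ m`). -/
def scaledBasis (r : ℝ) (n m : ℕ) : Finset (EuclideanSpace ℝ (Fin m)) :=
  (Finset.univ.filter fun i : Fin m => i.val < n).image fun i => EuclideanSpace.single i r

end SqFL

end

/-! Distinct points of `X` are at squared distance `2 * R ^ 2`, which exceeds the opening cost, so
opening all `n` points is optimal and `OPT(X) = n`. By Markov, with probability at least 2/3 the
images have total squared norm at most `3 * R ^ 2 * n`, so at most `3 * n / R ^ 2` of them leave the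
ball of radius `R ^ 2`. A `1 / R`-net of the images in this ball has at most `(3 * R ^ 3) ^ d`
points (`card_le_of_separated_of_norm_le`). Since `d = o(log n)`, the choice `R = n ^ (1 / (10 *
d))` tends to infinity and eventually keeps the net below `n / R ^ 2`. Opening the net and the
outliers costs at most `5 * n / R ^ 2` (`optCost_projImage_le`).

An optimal solution for `GX` then opens at most `n / 2` facilities. As `G` is almost surely
injective on `X`, its pullback leaves at least `n / 2` points closed, each paying `2 * R ^ 2`
(`le_cost_pullback`). -/

namespace SqFL

/-! ### Facility-location costs, separated sets and nets -/

section Cost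

variable {E : Type*} [NormedAddCommGroup E]

lemma iInf_norm_sub_sq_nonneg (F : Finset E) (x : E) : 0 ≤ ⨅ f : F, ‖x - (f : E)‖ ^ 2 :=
  Real.iInf_nonneg fun _ => sq_nonneg _

lemma iInf_norm_sub_sq_le {F : Finset E} (x : E) {f : E} (hf : f ∈ F) :
    ⨅ f : F, ‖x - (f : E)‖ ^ 2 ≤ ‖x - f‖ ^ 2 :=
  ciInf_le (f := fun f : F => ‖x - (f : E)‖ ^ 2)
    ⟨0, by rintro _ ⟨_, rfl⟩; exact sq_nonneg _⟩ ⟨f, hf⟩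

lemma card_le_cost (X F : Finset E) : (F.card : ℝ) ≤ cost X F :=
  le_add_of_nonneg_right (Finset.sum_nonneg fun x _ => iInf_norm_sub_sq_nonneg F x)

lemma cost_nonneg (X F : Finset E) : 0 ≤ cost X F :=
  (Nat.cast_nonneg _).trans (card_le_cost X F)

lemma optCost_le_cost {X F : Finset E} (h : IsSolution X F) : optCost X ≤ cost X F :=
  csInf_le ⟨0, by rintro _ ⟨F, -, rfl⟩; exact cost_nonneg X F⟩ ⟨F, h, rfl⟩

lemma cost_self_le (X : Finset E) : cost X X ≤ X.card := by
  have : ∑ x ∈ X, ⨅ f : X, ‖x - (f : E)‖ ^ 2 ≤ 0 :=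
    Finset.sum_nonpos fun x hx => (iInf_norm_sub_sq_le x hx).trans (by simp)
  unfold cost
  linarith

lemma optCost_le_card {X : Finset E} (h : X.Nonempty) : optCost X ≤ X.card :=
  (optCost_le_cost ⟨subset_rfl, h⟩).trans (cost_self_le X)

lemma le_optCost {X : Finset E} (hX : X.Nonempty) {c : ℝ}
    (h : ∀ F, IsSolution X F → c ≤ cost X F) : c ≤ optCost X :=
  le_csInf ⟨_, X, ⟨subset_rfl, hX⟩, rfl⟩ (by rintro _ ⟨F, hF, rfl⟩; exact h F hF)

lemma exists_isOptimal {X : Finset E} (hX : X.Nonempty) : ∃ F, IsOptimal X F := by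
  classical
  obtain ⟨F, hF, hmin⟩ := (X.powerset.filter Finset.Nonempty).exists_min_image (cost X)
    ⟨X, by simpa using hX⟩
  rw [Finset.mem_filter, Finset.mem_powerset] at hF
  refine ⟨F, hF, fun F' hF' => hmin F' ?_⟩
  rw [Finset.mem_filter, Finset.mem_powerset]
  exact hF'

lemma IsOptimal.cost_le_optCost {X F : Finset E} (h : IsOptimal X F) : cost X F ≤ optCost X :=
  le_optCost (h.1.2.mono h.1.1) h.2

/-- If distinct points of `X` are at squared distance at least `b`, then every point of `X` that
is not a facility contributes at least `b` to the cost. -/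
lemma le_cost_of_separated {X F : Finset E} (hF : IsSolution X F) {b : ℝ}
    (hb : ∀ x ∈ X, ∀ y ∈ X, x ≠ y → b ≤ ‖x - y‖ ^ 2) :
    (F.card : ℝ) + ((X.card : ℝ) - F.card) * b ≤ cost X F := by
  classical
  have hne : Nonempty F := hF.2.coe_sort
  have h1 : ∑ x ∈ X \ F, b ≤ ∑ x ∈ X \ F, ⨅ f : F, ‖x - (f : E)‖ ^ 2 := by
    refine Finset.sum_le_sum fun x hx => le_ciInf fun f => ?_
    rw [Finset.mem_sdiff] at hx
    exact hb x hx.1 f (hF.1 f.2) fun h => hx.2 (h ▸ f.2)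
  have h2 : ∑ x ∈ X \ F, ⨅ f : F, ‖x - (f : E)‖ ^ 2 ≤ ∑ x ∈ X, ⨅ f : F, ‖x - (f : E)‖ ^ 2 :=
    Finset.sum_le_sum_of_subset_of_nonneg Finset.sdiff_subset
      fun x _ _ => iInf_norm_sub_sq_nonneg F x
  rw [Finset.sum_const, nsmul_eq_mul, Finset.card_sdiff_of_subset hF.1,
    Nat.cast_sub (Finset.card_le_card hF.1)] at h1
  unfold cost
  linarith

lemma exists_maximal_separated (Y : Finset E) (ρ : ℝ) :
    ∃ S ⊆ Y, (∀ x ∈ S, ∀ y ∈ S, x ≠ y → ρ ≤ ‖x - y‖) ∧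
      ∀ y ∈ Y, y ∈ S ∨ ∃ x ∈ S, ‖y - x‖ < ρ := by
  classical
  obtain ⟨S, hS, hmax⟩ := (Y.powerset.filter
    fun S => ∀ x ∈ S, ∀ y ∈ S, x ≠ y → ρ ≤ ‖x - y‖).exists_max_image Finset.card ⟨∅, by simp⟩
  rw [Finset.mem_filter, Finset.mem_powerset] at hS
  refine ⟨S, hS.1, hS.2, fun y hy => ?_⟩
  -- An uncovered point could be added to `S`, against maximal cardinality.
  by_contra! hcon
  have hins := hmax (insert y S) (by
    rw [Finset.mem_filter, Finset.mem_powerset]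
    refine ⟨Finset.insert_subset hy hS.1, fun a ha b hb hab => ?_⟩
    rw [Finset.mem_insert] at ha hb
    rcases ha with rfl | ha <;> rcases hb with rfl | hb
    · exact absurd rfl hab
    · exact hcon.2 b hb
    · rw [norm_sub_rev]; exact hcon.2 a ha
    · exact hS.2 a ha b hb hab)
  rw [Finset.card_insert_of_notMem hcon.1] at hins
  omega

variable [NormedSpace ℝ E] [FiniteDimensional ℝ E]

/-- Volume bound for separated sets in a ball. -/
lemma card_le_of_separated_of_norm_le {S : Finset E} {ρ T : ℝ} (hρ : 0 < ρ) (hT : 0 ≤ T)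
    (hsep : ∀ x ∈ S, ∀ y ∈ S, x ≠ y → ρ ≤ ‖x - y‖) (hS : ∀ x ∈ S, ‖x‖ ≤ T) :
    (S.card : ℝ) ≤ (2 * T / ρ + 1) ^ Module.finrank ℝ E := by
  borelize E
  set μ : Measure E := Measure.addHaar
  set D := Module.finrank ℝ E
  have hρ2 : 0 < ρ / 2 := by positivity
  -- Disjoint balls of radius `ρ / 2` around `S` fit in the ball of radius `T + ρ / 2`; compare
  -- volumes.
  have hdisj : Set.PairwiseDisjoint (S : Set E) fun x => Metric.ball x (ρ / 2) := by
    intro x hx y hy hxy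
    refine Metric.ball_disjoint_ball ?_
    rw [dist_eq_norm]
    linarith [hsep x hx y hy hxy]
  have hsub : (⋃ x ∈ S, Metric.ball x (ρ / 2)) ⊆ Metric.ball (0 : E) (T + ρ / 2) := by
    refine Set.iUnion₂_subset fun x hx => Metric.ball_subset_ball' ?_
    rw [dist_zero_right]
    linarith [hS x hx]
  have hvol := measure_mono (μ := μ) hsub
  rw [measure_biUnion_finset hdisj fun _ _ => Metric.isOpen_ball.measurableSet] at hvol
  rw [Finset.sum_congr rfl fun x _ => Measure.addHaar_ball_of_pos μ x hρ2,
    Measure.addHaar_ball_of_pos μ 0 (by positivity : 0 < T + ρ / 2), Finset.sum_const, nsmul_eq_mul,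
    ← mul_assoc, ENNReal.mul_le_mul_iff_left (Metric.measure_ball_pos _ _ one_pos).ne'
      measure_ball_lt_top.ne, ← ENNReal.ofReal_natCast, ← ENNReal.ofReal_mul (by positivity),
    ENNReal.ofReal_le_ofReal_iff (by positivity), ← le_div_iff₀ (by positivity),
    ← div_pow] at hvol
  refine hvol.trans_eq ?_
  congr 1
  field_simp

open Classical in
/-- Facilities at a maximal `ρ`-separated set of the points in a ball and at all points outside
of this ball. -/
lemma optCost_le_of_ball {Y : Finset E} (hY : Y.Nonempty) {ρ T : ℝ} (hρ : 0 < ρ) (hT : 0 ≤ T) :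
    optCost Y ≤ (2 * T / ρ + 1) ^ Module.finrank ℝ E
      + ((Y.filter fun y => T < ‖y‖).card : ℝ) + Y.card * ρ ^ 2 := by
  obtain ⟨S, hSY, hsep, hcov⟩ := exists_maximal_separated (Y.filter fun y => ‖y‖ ≤ T) ρ
  set O := Y.filter fun y => T < ‖y‖
  have hcard := card_le_of_separated_of_norm_le hρ hT hsep
    fun x hx => (Finset.mem_filter.1 (hSY hx)).2
  have hnear : ∀ y ∈ Y, ∃ x ∈ S ∪ O, ‖y - x‖ ≤ ρ := by
    intro y hy
    rcases le_or_gt ‖y‖ T with h | h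
    · rcases hcov y (Finset.mem_filter.2 ⟨hy, h⟩) with h' | ⟨x, hx, hxy⟩
      · exact ⟨y, Finset.mem_union_left _ h', by simpa using hρ.le⟩
      · exact ⟨x, Finset.mem_union_left _ hx, hxy.le⟩
    · exact ⟨y, Finset.mem_union_right _ (Finset.mem_filter.2 ⟨hy, h⟩), by simpa using hρ.le⟩
  have hsol : IsSolution Y (S ∪ O) := by
    refine ⟨Finset.union_subset (hSY.trans (Finset.filter_subset _ _))
      (Finset.filter_subset _ _), ?_⟩
    obtain ⟨y, hy⟩ := hY
    obtain ⟨x, hx, -⟩ := hnear y hy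
    exact ⟨x, hx⟩
  refine (optCost_le_cost hsol).trans ?_
  have h1 : ∑ y ∈ Y, ⨅ f : (S ∪ O : Finset E), ‖y - (f : E)‖ ^ 2 ≤ ∑ y ∈ Y, ρ ^ 2 := by
    refine Finset.sum_le_sum fun y hy => ?_
    obtain ⟨x, hx, hxy⟩ := hnear y hy
    exact (iInf_norm_sub_sq_le y hx).trans (by gcongr)
  rw [Finset.sum_const, nsmul_eq_mul] at h1
  have h2 : ((S ∪ O).card : ℝ) ≤ S.card + O.card := mod_cast Finset.card_union_le S O
  unfold cost
  linarith

end Cost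

end SqFL

namespace SqFL

/-! ### The Gaussian matrix: second moments and almost sure injectivity -/

section Law

instance (d m : ℕ) : IsProbabilityMeasure (projLaw d m) := by
  unfold projLaw; infer_instance

lemma lintegral_sq_gaussianReal (v : ℝ≥0) :
    ∫⁻ x, ENNReal.ofReal (x ^ 2) ∂gaussianReal 0 v = v := by
  have h := (memLp_id_gaussianReal (μ := 0) (v := v) 2).ofReal_variance_eq
  rw [evariance_eq_lintegral_ofReal, variance_id_gaussianReal] at h
  simpa using h.symm

lemma lintegral_sq_projLaw {d m : ℕ} (j : Fin m) (i : Fin d) :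
    ∫⁻ g, ENNReal.ofReal (g j i ^ 2) ∂projLaw d m = ENNReal.ofReal (1 / d) := by
  have h1 := measurePreserving_eval
    (fun _ : Fin m => Measure.pi fun _ : Fin d => gaussianReal 0 (1 / (d : ℝ≥0))) j
  have h2 := measurePreserving_eval (fun _ : Fin d => gaussianReal 0 (1 / (d : ℝ≥0))) i
  have h := (h2.comp h1).lintegral_comp
    (f := fun x : ℝ => ENNReal.ofReal (x ^ 2)) (by fun_prop)
  rw [lintegral_sq_gaussianReal] at h
  refine h.trans ?_
  rw [← ENNReal.ofReal_coe_nnreal]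
  simp

/-- Two columns are independent with atomless law (here `d ≥ 1` matters), so the diagonal is null
for their joint law. -/
lemma ae_injective_projLaw {d : ℕ} (hd : 1 ≤ d) (m : ℕ) :
    ∀ᵐ g ∂projLaw d m, Function.Injective g := by
  have : Nonempty (Fin d) := ⟨⟨0, hd⟩⟩
  have hv : (1 / (d : ℝ≥0)) ≠ 0 := by positivity
  have := nullSingletonClass_gaussianReal (μ := 0) hv
  have key : ∀ i j : Fin m, i ≠ j → ∀ᵐ g ∂projLaw d m, g i ≠ g j := by
    intro i j hij
    set ν : Measure (Fin d → ℝ) := Measure.pi fun _ : Fin d => gaussianReal 0 (1 / (d : ℝ≥0))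
    have hind : iIndepFun (fun (i : Fin m) (g : Fin m → Fin d → ℝ) => g i) (projLaw d m) :=
      iIndepFun_pi (μ := fun _ : Fin m => ν) (X := fun _ x => x) fun _ => aemeasurable_id
    have hmap := (indepFun_iff_map_prod_eq_prod_map_map
      (measurable_pi_apply i).aemeasurable (measurable_pi_apply j).aemeasurable).1
      (hind.indepFun hij)
    have he : ∀ k : Fin m, (projLaw d m).map (fun g => g k) = ν := fun k =>
      (measurePreserving_eval (fun _ : Fin m => ν) k).map_eq
    rw [he, he] at hmap
    have hdiag : (ν.prod ν) (Set.diagonal (Fin d → ℝ)) = 0 := by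
      rw [Measure.measure_prod_null measurableSet_diagonal]
      refine Eventually.of_forall fun x => ?_
      have : Prod.mk x ⁻¹' Set.diagonal (Fin d → ℝ) = {x} := by
        ext y; simp [eq_comm]
      simp [this]
    rw [← hmap, Measure.map_apply (by fun_prop) measurableSet_diagonal] at hdiag
    exact measure_eq_zero_iff_ae_notMem.1 hdiag
  have : ∀ᵐ g ∂projLaw d m, ∀ i j : Fin m, i ≠ j → g i ≠ g j := by
    simpa only [ae_all_iff] using key
  filter_upwards [this] with g hg i j hij
  by_contra hne
  exact hg i j hne hij

/-- Markov's inequality: each column has expected squared norm `d * (1 / d) = 1`, so the sum has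
mean `s.card`. -/
lemma two_thirds_le_projLaw_sum_sq_le {d : ℕ} (hd : 1 ≤ d) {m : ℕ} (s : Finset (Fin m))
    (hs : s.Nonempty) :
    2 / 3 ≤ projLaw d m {g | ∑ j ∈ s, ∑ i, g j i ^ 2 ≤ 3 * s.card} := by
  set f : (Fin m → Fin d → ℝ) → ℝ := fun g => ∑ j ∈ s, ∑ i, g j i ^ 2
  have hf : Measurable f := by fun_prop
  have hint : ∫⁻ g, ENNReal.ofReal (f g) ∂projLaw d m = s.card := by
    have : ∀ g, ENNReal.ofReal (f g) = ∑ j ∈ s, ∑ i, ENNReal.ofReal (g j i ^ 2) := by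
      intro g
      rw [ENNReal.ofReal_sum_of_nonneg fun _ _ => by positivity]
      exact Finset.sum_congr rfl fun j _ =>
        ENNReal.ofReal_sum_of_nonneg fun _ _ => by positivity
    simp_rw [this]
    rw [lintegral_finsetSum _ fun j _ => by fun_prop]
    have hj : ∀ j ∈ s, ∫⁻ g, ∑ i, ENNReal.ofReal (g j i ^ 2) ∂projLaw d m = 1 := by
      intro j _
      rw [lintegral_finsetSum _ fun i _ => by fun_prop]
      simp_rw [lintegral_sq_projLaw]
      rw [Finset.sum_const, nsmul_eq_mul, Finset.card_univ, Fintype.card_fin,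
        ← ENNReal.ofReal_natCast, ← ENNReal.ofReal_mul (by positivity),
        mul_one_div_cancel (by positivity), ENNReal.ofReal_one]
    rw [Finset.sum_congr rfl hj]
    simp
  have hmarkov := mul_meas_ge_le_lintegral (μ := projLaw d m)
    (f := fun g => ENNReal.ofReal (f g)) (by fun_prop) (ENNReal.ofReal (3 * s.card))
  rw [hint] at hmarkov
  have hcard : (0 : ℝ) < s.card := mod_cast hs.card_pos
  set B := {g | ENNReal.ofReal (3 * s.card) ≤ ENNReal.ofReal (f g)}
  have hB : projLaw d m B ≤ 1 / 3 := by
    rw [ENNReal.ofReal_mul (by norm_num), ENNReal.ofReal_natCast, mul_right_comm,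
      mul_comm] at hmarkov
    have h3 : ENNReal.ofReal 3 * projLaw d m B ≤ 1 := by
      refine (ENNReal.mul_le_mul_iff_right (a := (s.card : ℝ≥0∞)) (by
        exact_mod_cast hs.card_pos.ne') (ENNReal.natCast_ne_top _)).1 ?_
      rwa [mul_one]
    rw [ENNReal.le_div_iff_mul_le (by simp) (by simp), mul_comm]
    simpa using h3
  have hBm : MeasurableSet B := measurableSet_le measurable_const (by fun_prop)
  have hcompl : Bᶜ ⊆ {g | f g ≤ 3 * s.card} := by
    intro g hg
    by_contra h
    exact hg (ENNReal.ofReal_le_ofReal (not_le.1 h).le)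
  refine le_trans ?_ (measure_mono hcompl)
  rw [prob_compl_eq_one_sub hBm]
  refine le_trans ?_ (tsub_le_tsub_left hB 1)
  refine ENNReal.le_sub_of_add_le_right (by simp) ?_
  rw [ENNReal.div_add_div_same]
  norm_num

end Law

end SqFL

namespace SqFL

/-! ### The scaled basis before projection -/

section Basis

variable {m : ℕ}

lemma card_filter_val_lt {n : ℕ} (h : n ≤ m) :
    (Finset.univ.filter fun i : Fin m => i.val < n).card = n := by
  rw [Fin.card_filter_val_lt, min_eq_right h]

lemma card_scaledBasis {r : ℝ} (hr : 1 ≤ r) {n : ℕ} (h : n ≤ m) :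
    (scaledBasis r n m).card = n := by
  classical
  rw [scaledBasis, Finset.card_image_of_injective, card_filter_val_lt h]
  intro i j hij
  by_contra hne
  have h1 := congrArg (fun v : EuclideanSpace ℝ (Fin m) => v i) hij
  simp [hne] at h1
  linarith

lemma norm_single_sub_single_sq {i j : Fin m} (hij : i ≠ j) (r : ℝ) :
    ‖EuclideanSpace.single i r - EuclideanSpace.single j r‖ ^ 2 = 2 * r ^ 2 := by
  rw [norm_sub_sq_real, EuclideanSpace.inner_single_left]
  simp [hij]
  ring

lemma two_mul_sq_le_of_mem_scaledBasis {r : ℝ} {n : ℕ} :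
    ∀ x ∈ scaledBasis r n m, ∀ y ∈ scaledBasis r n m, x ≠ y → 2 * r ^ 2 ≤ ‖x - y‖ ^ 2 := by
  intro x hx y hy hxy
  simp only [scaledBasis, Finset.mem_image] at hx hy
  obtain ⟨i, -, rfl⟩ := hx
  obtain ⟨j, -, rfl⟩ := hy
  exact (norm_single_sub_single_sq (fun h => hxy (by rw [h])) r).ge

lemma optCost_scaledBasis {r : ℝ} (hr : 1 ≤ r) {n : ℕ} (hn : 1 ≤ n) (h : n ≤ m) :
    optCost (scaledBasis r n m) = n := by
  have hcard := card_scaledBasis hr h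
  have hne : (scaledBasis r n m).Nonempty := Finset.card_pos.1 (by omega)
  refine le_antisymm ((optCost_le_card hne).trans_eq (by rw [hcard])) (le_optCost hne ?_)
  intro F hF
  have h1 := le_cost_of_separated hF two_mul_sq_le_of_mem_scaledBasis
  -- The excess of the cost over `n` is at least `(n - F.card) * (2 * r ^ 2 - 1)`.
  have h2 : (F.card : ℝ) ≤ n := mod_cast (Finset.card_le_card hF.1).trans_eq hcard
  rw [hcard] at h1
  nlinarith [mul_nonneg (sub_nonneg.2 h2) (by nlinarith : 0 ≤ 2 * r ^ 2 - 1)]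

end Basis

/-! ### The projected dataset and the pullback -/

section Projection

variable {d m : ℕ} (g : Fin m → Fin d → ℝ)

lemma proj_single (j : Fin m) (r : ℝ) :
    proj g (EuclideanSpace.single j r) = r • WithLp.toLp 2 (g j) := by
  ext i
  simp [proj, Matrix.toLpLin_apply]

lemma proj_single_injective {g : Fin m → Fin d → ℝ} (hg : Function.Injective g) {r : ℝ}
    (hr : r ≠ 0) : Function.Injective fun j => proj g (EuclideanSpace.single j r) := by
  intro i j hij
  simp only [proj_single] at hij
  exact hg (WithLp.toLp_injective 2 (smul_right_injective _ hr hij))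

open Classical in
lemma projImage_scaledBasis (r : ℝ) (n : ℕ) :
    projImage g (scaledBasis r n m) = (Finset.univ.filter fun i : Fin m => i.val < n).image
      fun j => proj g (EuclideanSpace.single j r) := by
  rw [projImage, scaledBasis, Finset.image_image]
  rfl

lemma projImage_nonempty {r : ℝ} (hr : 1 ≤ r) {n : ℕ} (hn : 1 ≤ n) (h : n ≤ m) :
    (projImage g (scaledBasis r n m)).Nonempty := by
  classical
  refine Finset.Nonempty.image (Finset.card_pos.1 ?_) _
  rw [card_scaledBasis hr h]
  exact hn

lemma card_projImage_le {r : ℝ} (hr : 1 ≤ r) {n : ℕ} (h : n ≤ m) :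
    (projImage g (scaledBasis r n m)).card ≤ n := by
  classical
  exact Finset.card_image_le.trans_eq (card_scaledBasis hr h)

lemma norm_proj_single_sq (j : Fin m) (r : ℝ) :
    ‖proj g (EuclideanSpace.single j r)‖ ^ 2 = r ^ 2 * ∑ i, g j i ^ 2 := by
  rw [proj_single, norm_smul, mul_pow, EuclideanSpace.norm_sq_eq]
  simp

variable {g}

-- Each image outside the ball contributes more than `T ^ 2` to the total squared norm.
open Classical in
lemma card_filter_projImage_mul_le {r T : ℝ} (hT : 0 ≤ T) (n : ℕ) :
    (((projImage g (scaledBasis r n m)).filter fun y => T < ‖y‖).card : ℝ) * T ^ 2 ≤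
      r ^ 2 * ∑ j with j.val < n, ∑ i, g j i ^ 2 := by
  rw [projImage_scaledBasis, Finset.filter_image]
  set J := Finset.univ.filter fun j : Fin m => j.val < n
  set K := J.filter fun j => T < ‖proj g (EuclideanSpace.single j r)‖
  calc _ ≤ (K.card : ℝ) * T ^ 2 := by
        gcongr
        exact Finset.card_image_le
    _ = ∑ j ∈ K, T ^ 2 := by rw [Finset.sum_const, nsmul_eq_mul]
    _ ≤ ∑ j ∈ K, r ^ 2 * ∑ i, g j i ^ 2 := by
        refine Finset.sum_le_sum fun j hj => ?_
        rw [← norm_proj_single_sq]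
        have := (Finset.mem_filter.1 hj).2
        gcongr
    _ ≤ ∑ j ∈ J, r ^ 2 * ∑ i, g j i ^ 2 :=
        Finset.sum_le_sum_of_subset_of_nonneg (Finset.filter_subset _ _)
          fun _ _ _ => by positivity
    _ = _ := by rw [Finset.mul_sum]

lemma optCost_projImage_le {r : ℝ} (hr : 1 ≤ r) {n : ℕ} (hn : 1 ≤ n) (h : n ≤ m)
    (hsum : ∑ j : Fin m with j.val < n, ∑ i, g j i ^ 2 ≤ 3 * (n : ℝ))
    (hd : (3 * r ^ 3) ^ d ≤ n / r ^ 2) :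
    optCost (projImage g (scaledBasis r n m)) ≤ 5 / r ^ 2 * n := by
  classical
  have hr0 : 0 < r := by linarith
  -- These radii bound the net, the outliers and the connection cost by `n / r ^ 2`, `3 * n / r ^ 2`
  -- and `n / r ^ 2`.
  have h1 := optCost_le_of_ball (projImage_nonempty g hr hn h) (ρ := 1 / r) (T := r ^ 2)
    (by positivity) (by positivity)
  have h2 := card_filter_projImage_mul_le (g := g) (r := r) (T := r ^ 2) (by positivity) n
  have h3 : ((projImage g (scaledBasis r n m)).card : ℝ) ≤ n := mod_cast card_projImage_le g hr h
  rw [finrank_euclideanSpace_fin] at h1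
  have h4 : (2 * r ^ 2 / (1 / r) + 1) ^ d ≤ (3 * r ^ 3) ^ d := by
    refine pow_le_pow_left₀ (by positivity) ?_ d
    have : 1 ≤ r ^ 3 := one_le_pow₀ hr
    have e : 2 * r ^ 2 / (1 / r) = 2 * r ^ 3 := by field_simp
    linarith
  set O := (projImage g (scaledBasis r n m)).filter fun y => r ^ 2 < ‖y‖
  have h5 : (O.card : ℝ) ≤ 3 * n / r ^ 2 := by
    rw [le_div_iff₀ (by positivity)]
    have : (O.card * r ^ 2) * r ^ 2 ≤ (3 * n) * r ^ 2 := by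
      calc _ = O.card * (r ^ 2) ^ 2 := by ring
        _ ≤ _ := h2
        _ ≤ r ^ 2 * (3 * n) := by gcongr
        _ = _ := by ring
    exact le_of_mul_le_mul_right this (by positivity)
  have h6 : ((projImage g (scaledBasis r n m)).card : ℝ) * (1 / r) ^ 2 ≤ n / r ^ 2 := by
    rw [one_div, inv_pow, ← div_eq_mul_inv]
    gcongr
  calc _ ≤ n / r ^ 2 + 3 * n / r ^ 2 + n / r ^ 2 := by linarith
    _ = _ := by ring

lemma card_pullback_le (hg : Function.Injective g) {r : ℝ} (hr : r ≠ 0) (n : ℕ)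
    (F : Finset (EuclideanSpace ℝ (Fin d))) :
    (pullback g (scaledBasis r n m) F).card ≤ F.card := by
  classical
  refine Finset.card_le_card_of_injOn (proj g) (fun x hx => (Finset.mem_filter.1 hx).2) ?_
  intro x hx y hy hxy
  have hx' := (Finset.mem_filter.1 hx).1
  have hy' := (Finset.mem_filter.1 hy).1
  simp only [scaledBasis, Finset.mem_image] at hx' hy'
  obtain ⟨i, -, rfl⟩ := hx'
  obtain ⟨j, -, rfl⟩ := hy'
  rw [proj_single_injective hg hr hxy]

lemma IsSolution.pullback {X : Finset (EuclideanSpace ℝ (Fin m))}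
    {F : Finset (EuclideanSpace ℝ (Fin d))} (hF : IsSolution (projImage g X) F) :
    IsSolution X (pullback g X F) := by
  classical
  refine ⟨Finset.filter_subset _ _, ?_⟩
  obtain ⟨y, hy⟩ := hF.2
  obtain ⟨x, hx, rfl⟩ := Finset.mem_image.1 (hF.1 hy)
  exact ⟨x, Finset.mem_filter.2 ⟨hx, hy⟩⟩

lemma le_cost_pullback (hg : Function.Injective g) {r : ℝ} (hr : 1 ≤ r) {n : ℕ} (h : n ≤ m)
    {F : Finset (EuclideanSpace ℝ (Fin d))}
    (hF : IsSolution (projImage g (scaledBasis r n m)) F) (hcard : (F.card : ℝ) ≤ n / 2) :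
    r ^ 2 * n ≤ cost (scaledBasis r n m) (pullback g (scaledBasis r n m) F) := by
  have h1 := le_cost_of_separated hF.pullback two_mul_sq_le_of_mem_scaledBasis
  have h2 : ((pullback g (scaledBasis r n m) F).card : ℝ) ≤ F.card :=
    mod_cast card_pullback_le hg (by positivity) n F
  rw [card_scaledBasis hr h] at h1
  refine le_trans ?_ h1
  set k : ℝ := ((pullback g (scaledBasis r n m) F).card : ℝ)
  have hk : 0 ≤ k := Nat.cast_nonneg _
  nlinarith [mul_nonneg (by linarith : (0 : ℝ) ≤ n / 2 - k) (sq_nonneg r)]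

end Projection

/-! ### Growth of the scale factor -/

section Scale

variable {d : ℕ → ℕ}

/-- The scale factor `n ^ (1 / (10 d))`. -/
noncomputable def scale (d : ℕ → ℕ) (n : ℕ) : ℝ := Real.exp (Real.log n / (10 * d n))

lemma one_le_scale (d : ℕ → ℕ) (n : ℕ) : 1 ≤ scale d n :=
  Real.one_le_exp (div_nonneg (Real.log_natCast_nonneg n) (by positivity))

lemma tendsto_log_div_atTop (hd_pos : ∀ n, 1 ≤ d n)
    (hd : (fun n : ℕ => (d n : ℝ)) =o[atTop] fun n : ℕ => Real.log (n : ℝ)) :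
    Tendsto (fun n : ℕ => Real.log n / d n) atTop atTop := by
  have hpos : ∀ n, (0 : ℝ) < d n := fun n => mod_cast hd_pos n
  refine tendsto_atTop.2 fun b => ?_
  filter_upwards [hd.bound (c := 1 / (|b| + 1)) (by positivity)] with n hn
  rw [Real.norm_of_nonneg (hpos n).le, Real.norm_of_nonneg (Real.log_natCast_nonneg n),
    one_div, inv_mul_eq_div, le_div_iff₀ (by positivity)] at hn
  rw [le_div_iff₀ (hpos n)]
  nlinarith [le_abs_self b, hpos n]

lemma tendsto_scale_atTop (hd_pos : ∀ n, 1 ≤ d n)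
    (hd : (fun n : ℕ => (d n : ℝ)) =o[atTop] fun n : ℕ => Real.log (n : ℝ)) :
    Tendsto (scale d) atTop atTop := by
  refine Real.tendsto_exp_atTop.comp ?_
  refine ((tendsto_log_div_atTop hd_pos hd).atTop_div_const (r := 10) (by norm_num)).congr ?_
  intro n
  rw [div_div, mul_comm]

lemma eventually_pow_scale_le (hd_pos : ∀ n, 1 ≤ d n)
    (hd : (fun n : ℕ => (d n : ℝ)) =o[atTop] fun n : ℕ => Real.log (n : ℝ)) :
    ∀ᶠ n in atTop, (3 * scale d n ^ 3) ^ d n ≤ n / scale d n ^ 2 := by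
  filter_upwards [(tendsto_log_div_atTop hd_pos hd).eventually_ge_atTop 4,
    eventually_ge_atTop 1] with n hL hn
  have hpos : (1 : ℝ) ≤ d n := mod_cast hd_pos n
  have hlog := Real.log_natCast_nonneg n
  have hs : 0 < scale d n := Real.exp_pos _
  rw [le_div_iff₀ (by linarith)] at hL
  have h3 : (3 : ℝ) ≤ Real.exp 2 := by
    have := Real.add_one_le_exp (2 : ℝ); linarith
  have e : ∀ k : ℕ, scale d n ^ k = Real.exp (k * (Real.log n / (10 * d n))) := fun k =>
    (Real.exp_nat_mul _ k).symm
  rw [le_div_iff₀ (by positivity)]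
  calc (3 * scale d n ^ 3) ^ d n * scale d n ^ 2
      ≤ (Real.exp 2 * scale d n ^ 3) ^ d n * scale d n ^ 2 := by gcongr
    _ = Real.exp (d n * (2 + (3 : ℕ) * (Real.log n / (10 * d n)))
          + (2 : ℕ) * (Real.log n / (10 * d n))) := by
        rw [e, e, ← Real.exp_add, ← Real.exp_nat_mul, ← Real.exp_add]
    -- With `4 * d ≤ log n`, the exponent is at most `(1/2 + 3/10 + 2/10) * log n`, from `2 * d`,
    -- the cubes and the square.
    _ ≤ Real.exp (Real.log n) := by
        refine Real.exp_le_exp.2 ?_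
        have h1 : Real.log n / (10 * d n) ≤ Real.log n / 10 :=
          div_le_div_of_nonneg_left hlog (by norm_num) (by linarith)
        have h2 : (d n : ℝ) * (Real.log n / (10 * d n)) = Real.log n / 10 := by field_simp
        push_cast
        linarith [mul_add (d n : ℝ) 2 (3 * (Real.log n / (10 * d n))),
          mul_left_comm (d n : ℝ) 3 (Real.log n / (10 * d n))]
    _ = n := Real.exp_log (mod_cast hn)

end Scale

end SqFL

/-! ### Choice of `R`, `ε`, `A` and conclusion -/

theorem theoremF8 (d : ℕ → ℕ) (hd_pos : ∀ n, 1 ≤ d n)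
    (hd : (fun n : ℕ => (d n : ℝ)) =o[atTop] fun n : ℕ => Real.log (n : ℝ)) :
    ∃ R ε A : ℕ → ℝ,
      (∀ n, 1 ≤ R n) ∧ Tendsto ε atTop (𝓝 0) ∧ Tendsto A atTop atTop ∧
      ∀ n m : ℕ, 1 ≤ n → n ≤ m →
        (SqFL.scaledBasis (R n) n m).card = n ∧
        2 / 3 ≤ SqFL.projLaw (d n) m
          {g | SqFL.optCost (SqFL.projImage g (SqFL.scaledBasis (R n) n m))
                ≤ ε n * SqFL.optCost (SqFL.scaledBasis (R n) n m) ∧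
            (∃ F, SqFL.IsOptimal (SqFL.projImage g (SqFL.scaledBasis (R n) n m)) F) ∧
            ∀ F, SqFL.IsOptimal (SqFL.projImage g (SqFL.scaledBasis (R n) n m)) F →
              A n * SqFL.optCost (SqFL.scaledBasis (R n) n m)
                ≤ SqFL.cost (SqFL.scaledBasis (R n) n m)
                    (SqFL.pullback g (SqFL.scaledBasis (R n) n m) F)} := by
 
  classical
  have hR := SqFL.one_le_scale d
  have hlim := SqFL.tendsto_scale_atTop hd_pos hd
  have hlim2 : Tendsto (fun n => SqFL.scale d n ^ 2) atTop atTop :=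
    (tendsto_pow_atTop two_ne_zero).comp hlim
  -- For the finitely many other `n`, the values `ε = 1` and `A = 0` make both claims trivial. The
  -- bound 10 gives `5 / R ^ 2 ≤ 1 / 2`.
  let good : ℕ → Prop := fun n =>
    (3 * SqFL.scale d n ^ 3) ^ d n ≤ n / SqFL.scale d n ^ 2 ∧ 10 ≤ SqFL.scale d n ^ 2
  have hgood : ∀ᶠ n in atTop, good n :=
    (SqFL.eventually_pow_scale_le hd_pos hd).and (hlim2.eventually_ge_atTop 10)
  refine ⟨SqFL.scale d, fun n => if good n then 5 / SqFL.scale d n ^ 2 else 1,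
    fun n => if good n then SqFL.scale d n ^ 2 else 0, hR, ?_, ?_, ?_⟩
  · refine (hlim2.const_div_atTop 5).congr' ?_
    filter_upwards [hgood] with n hn
    rw [if_pos hn]
  · refine hlim2.congr' ?_
    filter_upwards [hgood] with n hn
    rw [if_pos hn]
  intro n m hn hnm
  refine ⟨SqFL.card_scaledBasis (hR n) hnm, ?_⟩
  rw [SqFL.optCost_scaledBasis (hR n) hn hnm]
  by_cases hg : good n
  · simp only [if_pos hg]
    have hJ := SqFL.card_filter_val_lt hnm
    have hprob := SqFL.two_thirds_le_projLaw_sum_sq_le (hd_pos n)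
      (Finset.univ.filter fun i : Fin m => i.val < n) (Finset.card_pos.1 (by omega))
    rw [hJ] at hprob
    refine hprob.trans (measure_mono_ae ?_)
    filter_upwards [SqFL.ae_injective_projLaw (hd_pos n) m] with g hinj hsum
    have hopt := SqFL.optCost_projImage_le (hR n) hn hnm hsum hg.1
    refine ⟨hopt, SqFL.exists_isOptimal (SqFL.projImage_nonempty g (hR n) hn hnm), ?_⟩
    intro F hF
    refine SqFL.le_cost_pullback hinj (hR n) hnm hF.1 ?_
    -- Each facility costs 1, so the cheap optimum bounds their number.
    refine (SqFL.card_le_cost _ F).trans (hF.cost_le_optCost.trans (hopt.trans ?_))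
    have h2 : 5 / SqFL.scale d n ^ 2 ≤ 1 / 2 := by
      rw [div_le_div_iff₀ (by linarith [hg.2]) two_pos]
      linarith [hg.2]
    calc 5 / SqFL.scale d n ^ 2 * (n : ℝ) ≤ 1 / 2 * n := by gcongr
      _ = n / 2 := by ring
  · simp only [if_neg hg, one_mul, zero_mul]
    refine le_trans ?_ (measure_mono (s := Set.univ) ?_)
    · rw [measure_univ]
      exact ENNReal.div_le_of_le_mul (by norm_num)
    · intro g _
      have hne := SqFL.projImage_nonempty g (hR n) hn hnm
      refine ⟨(SqFL.optCost_le_card hne).trans ?_, SqFL.exists_isOptimal hne,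
        fun F _ => SqFL.cost_nonneg _ _⟩
      exact_mod_cast SqFL.card_projImage_le g (hR n) hnm
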